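/- Let $U\subset\mathbb R^2\cong\mathbb C$ be open, with coordinate $z=x+iy$, carrying the metric $e^{2\rho}(dx^2+dy^2)$ with $\rho:U\to\mathbb R$ smooth. Let $E$ be an oriented Euclidean rank-two bundle over $U$, trivialized by a positive orthonormal frame $(e_3,e_4)$ and equipped with a metric connection $\nabla^E$, put $c_x=\langle\nabla^E_{\partial/\partial x}e_3,e_4\rangle$, $c_y=\langle\nabla^E_{\partial/\partial y}e_3,e_4\rangle$, and let $\vec H=H_3e_3+H_4e_4$ be a section of $E$. Let $i,j,k$ be the quaternion units, regard $\mathbb C=\mathbb R\oplus i\mathbb R\subset\mathbb H$, and identify $\mathbb R^4$ with $\mathbb H$ through the basis $1,i,j,k$. Write $\partial\rho/\partial z=\frac12(\rho_x-i\rho_y)$ and $\partial\rho/\partial\bar z=\frac12(\rho_x+i\rho_y)$. Let $a,b:U\to\mathbb H$ be smooth (the quaternionic components of a section of $\Sigma M\otimes\Sigma E$), with $|a|$ and $|b|$ equal to nonzero constants, and suppose that on $U$ $$\Big(\frac{\partial b}{\partial x}+i\frac{\partial b}{\partial y}\Big)b^{-1}=-\frac{\partial\rho}{\partial\bar z}+\frac{c_y-ic_x}{2}+e^{\rho}(H_3j+H_4k),$$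 $$\Big(\frac{\partial a}{\partial x}-i\frac{\partial a}{\partial y}\Big)a^{-1}=-\frac{\partial\rho}{\partial z}-\frac{c_y+ic_x}{2}-e^{\rho}(H_3j+H_4k).$$ Then the $\mathbb H$-valued $1$-form $\xi=e^{\rho}a^{-1}(dx+i\,dy)\,b$ is closed on $U$. In particular every point of $U$ has an open neighbourhood on which there is $f$ with $df=\xi$. If $V\subset U$ is open and $f:V\to\mathbb H\cong\mathbb R^4$ satisfies $df=\xi$, then $f$ is a smooth immersion. If moreover $|a|=|b|$, then: 1. $f$ induces the metric $e^{2\rho}(dx^2+dy^2)$ on $V$. 2. There is a smooth bundle isometry $\Phi$ from $E|_V$ onto the normal bundle of $f$ that carries $\nabla^E$ to the normal connection of $f$ and $\vec H$ to the mean curvature vector of $f$ (half the trace of the second fundamental form). 3. For this $\Phi$, there is a smooth map $(p,q):V\to S^3\times S^3=\mathrm{Spin}(4)$ with $p\,q^{-1}=e^{-\rho}f_x$, $p\,i\,q^{-1}=e^{-\rho}f_y$, $p\,j\,q^{-1}=\Phi(e_3)$, $p\,k\,q^{-1}=\Phi(e_4)$ such that the spinor field $((p,q),(a,b))$ along $f$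 is the restriction of a parallel spinor field of $\mathbb R^4$; if $V$ is connected, this holds for every smooth $(p,q)$ satisfying these four equations. Here a spinor of $\mathbb R^4$ at a point is a class of pairs $((p,q),(a,b))\in(S^3\times S^3)\times\mathbb H^2$ modulo $((p,q),(a,b))\sim((pp_1^{-1},qq_1^{-1}),(p_1a,q_1b))$ for $(p_1,q_1)\in S^3\times S^3$, and a spinor field is parallel if its components in the constant spinor frame $(1,1)$ have zero derivative. -/

import Mathlib

open scoped Quaternion ContDiff

noncomputable section

namespace SpinSurface

/-! ### Quaternions and the coordinate plane

The parameter plane is `ℂ`, with coordinate `z = x + i y`; it is embedded in `ℍ` by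
`x + i y ↦ x + y i` (the coercion `ℂ → ℍ`). Euclidean `ℝ⁴` is `ℍ` with the basis `1, i, j, k`. -/

/-- The quaternion `i`. -/
def qi : ℍ := ⟨0, 1, 0, 0⟩

/-- The quaternion `j`. -/
def qj : ℍ := ⟨0, 0, 1, 0⟩

/-- The quaternion `k`. -/
def qk : ℍ := ⟨0, 0, 0, 1⟩

section Derivatives

variable {W : Type*} [NormedAddCommGroup W] [NormedSpace ℝ W]

/-- `∂u/∂x`. -/
def dX (u : ℂ → W) (z : ℂ) : W := fderiv ℝ u z 1

/-- `∂u/∂y`. -/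
def dY (u : ℂ → W) (z : ℂ) : W := fderiv ℝ u z Complex.I

end Derivatives

/-- `∂ρ/∂z = (ρ_x - i ρ_y) / 2` for a real function `ρ`, as a quaternion. -/
def dZ (ρ : ℂ → ℝ) (z : ℂ) : ℍ := (1 / 2 : ℝ) • (((dX ρ z : ℝ) : ℍ) - qi * ((dY ρ z : ℝ) : ℍ))

/-- `∂ρ/∂z̄ = (ρ_x + i ρ_y) / 2` for a real function `ρ`, as a quaternion. -/
def dZbar (ρ : ℂ → ℝ) (z : ℂ) : ℍ := (1 / 2 : ℝ) • (((dX ρ z : ℝ) : ℍ) + qi * ((dY ρ z : ℝ) : ℍ))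

/-! ### The rank two bundle `E` and its connection -/

/-- The fibre of the oriented Euclidean rank two bundle `E` over the coordinate domain,
trivialized by its positive orthonormal frame `(e₃, e₄)`. -/
abbrev EFiber : Type := EuclideanSpace ℝ (Fin 2)

/-- The first frame section `e₃` of `E`. -/
def e3 : EFiber := EuclideanSpace.single 0 1

/-- The second frame section `e₄` of `E`. -/
def e4 : EFiber := EuclideanSpace.single 1 1

/-- A metric connection `∇ᴱ` on `E` over `U`: a covariant derivative on `U`, compatible with the
inner product of the fibres. `cov s z X` is `(∇ᴱ_X s)(z)`. -/
structure MetricConnection (U : Set ℂ) where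
  /-- The covariant derivative of a section. -/
  cov : (ℂ → EFiber) → ∀ _ : ℂ, ℂ →L[ℝ] EFiber
  isCovariantDerivativeOn :
    IsCovariantDerivativeOn (I := modelWithCornersSelf ℝ ℂ) EFiber
      (V := Bundle.Trivial ℂ EFiber) cov U
  metric : ∀ z ∈ U, ∀ s t : ℂ → EFiber, DifferentiableAt ℝ s z → DifferentiableAt ℝ t z →
    ∀ X : ℂ, fderiv ℝ (fun w => inner ℝ (s w) (t w)) z X
      = inner ℝ (cov s z X) (t z) + inner ℝ (s z) (cov t z X)

/-- `c_x = ⟨∇ᴱ_{∂/∂x} e₃, e₄⟩`. -/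
def MetricConnection.cx {U : Set ℂ} (D : MetricConnection U) (z : ℂ) : ℝ :=
  inner ℝ (D.cov (fun _ => e3) z 1) e4

/-- `c_y = ⟨∇ᴱ_{∂/∂y} e₃, e₄⟩`. -/
def MetricConnection.cy {U : Set ℂ} (D : MetricConnection U) (z : ℂ) : ℝ :=
  inner ℝ (D.cov (fun _ => e3) z Complex.I) e4

/-! ### The Dirac system and the form `ξ` -/

/-- The intrinsic Dirac system on `U` for the quaternionic components `(a, b)` of a twisted spinor,
for the metric `e^{2ρ} |dz|²`, the connection `D` on `E` and the section `H = H₃ e₃ + H₄ e₄`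
of `E`. -/
def SolvesDirac {U : Set ℂ} (ρ : ℂ → ℝ) (D : MetricConnection U) (H : ℂ → EFiber)
    (a b : ℂ → ℍ) : Prop :=
  ∀ z ∈ U,
    (dX b z + qi * dY b z) * (b z)⁻¹
        = - dZbar ρ z + (1 / 2 : ℝ) • (((D.cy z : ℝ) : ℍ) - qi * ((D.cx z : ℝ) : ℍ))
          + Real.exp (ρ z) • ((H z 0) • qj + (H z 1) • qk)
    ∧ (dX a z - qi * dY a z) * (a z)⁻¹
        = - dZ ρ z - (1 / 2 : ℝ) • (((D.cy z : ℝ) : ℍ) + qi * ((D.cx z : ℝ) : ℍ))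
          - Real.exp (ρ z) • ((H z 0) • qj + (H z 1) • qk)

/-- The `ℍ`-valued one-form `dx + i dy`, i.e. `X ↦ X` under `ℂ ⊆ ℍ`. -/
def dz : ℂ →L[ℝ] ℍ := LinearMap.toContinuousLinearMap Quaternion.ofComplex.toLinearMap

/-- The `ℍ`-valued one-form `ξ = e^ρ a⁻¹ (dx + i dy) b`. -/
def xi (ρ : ℂ → ℝ) (a b : ℂ → ℍ) (z : ℂ) : ℂ →L[ℝ] ℍ :=
  Real.exp (ρ z) •
    ((ContinuousLinearMap.mul ℝ ℍ (a z)⁻¹).comp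
      (((ContinuousLinearMap.mul ℝ ℍ).flip (b z)).comp dz))

theorem xi_apply (ρ : ℂ → ℝ) (a b : ℂ → ℍ) (z X : ℂ) :
    xi ρ a b z X = Real.exp (ρ z) • ((a z)⁻¹ * ((X : ℍ) * b z)) := rfl

/-- The `ℍ`-valued one-form `η` is closed on `U`: its exterior derivative vanishes there. -/
def IsClosedFormOn (η : ℂ → ℂ →L[ℝ] ℍ) (U : Set ℂ) : Prop :=
  ∀ z ∈ U, extDeriv
    (fun w => ContinuousAlternatingMap.ofSubsingleton ℝ ℂ ℍ (0 : Fin 1) (η w)) z = 0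

/-- `f` is a primitive of `η` on `V`: `df = η`. -/
def IsPrimitiveOn (η : ℂ → ℂ →L[ℝ] ℍ) (V : Set ℂ) (f : ℂ → ℍ) : Prop :=
  ∀ z ∈ V, HasFDerivAt f (η z) z

/-! ### Immersed surfaces in `ℝ⁴ = ℍ` -/

/-- `f` is a smooth immersion on `V`. -/
def IsImmersionOn (f : ℂ → ℍ) (V : Set ℂ) : Prop :=
  ContDiffOn ℝ ∞ f V ∧ ∀ z ∈ V, Function.Injective (fderiv ℝ f z)

/-- `f` induces on `V` the metric `e^{2ρ} |dz|²`. -/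
def InducesMetricOn (f : ℂ → ℍ) (ρ : ℂ → ℝ) (V : Set ℂ) : Prop :=
  ∀ z ∈ V, ∀ X Y : ℂ,
    inner ℝ (fderiv ℝ f z X) (fderiv ℝ f z Y) = Real.exp (2 * ρ z) * inner ℝ X Y

/-- The normal space of `f` at `z`. -/
def normalSpace (f : ℂ → ℍ) (z : ℂ) : Submodule ℝ ℍ :=
  (LinearMap.range (fderiv ℝ f z : ℂ →ₗ[ℝ] ℍ))ᗮ

/-- The orthogonal projection of `ℝ⁴` onto the normal space of `f` at `z`. -/
def normalProj (f : ℂ → ℍ) (z : ℂ) : ℍ →L[ℝ] ℍ := (normalSpace f z).starProjection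

/-- The normal connection `(∇^⊥_X ν)(z)` of `f`. -/
def normalCov (f : ℂ → ℍ) (ν : ℂ → ℍ) (z X : ℂ) : ℍ := normalProj f z (fderiv ℝ ν z X)

/-- The second fundamental form `𝓑(X, Y)` of `f` at `z`. -/
def secondFF (f : ℂ → ℍ) (z X Y : ℂ) : ℍ :=
  normalProj f z (fderiv ℝ (fun w => fderiv ℝ f w Y) z X)

/-- The mean curvature vector `(𝓑(e₁, e₁) + 𝓑(e₂, e₂)) / 2` of `f`, computed in the frame
`(e₁, e₂) = e^{-ρ} (∂/∂x, ∂/∂y)`, which is orthonormal when `f` induces `e^{2ρ} |dz|²`. -/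
def meanCurvature (ρ : ℂ → ℝ) (f : ℂ → ℍ) (z : ℂ) : ℍ :=
  (1 / 2 : ℝ) •
    (secondFF f z ((Real.exp (-ρ z) : ℝ) : ℂ) ((Real.exp (-ρ z) : ℝ) : ℂ)
      + secondFF f z (((Real.exp (-ρ z) : ℝ) : ℂ) * Complex.I)
          (((Real.exp (-ρ z) : ℝ) : ℂ) * Complex.I))

/-- `Φ` identifies `E` over `V` with the normal bundle of `f`: it is a smooth bundle isometry
onto the normal bundle. -/
def IsNormalIdentification (f : ℂ → ℍ) (V : Set ℂ) (Φ : ℂ → EFiber →ₗᵢ[ℝ] ℍ) : Prop :=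
  (∀ v : EFiber, ContDiffOn ℝ ∞ (fun z => Φ z v) V) ∧
  ∀ z ∈ V, LinearMap.range (Φ z).toLinearMap = normalSpace f z

/-- `Φ` carries the connection `D` of `E` to the normal connection of `f`, over `V`. -/
def PreservesConnection {U : Set ℂ} (D : MetricConnection U) (f : ℂ → ℍ) (V : Set ℂ)
    (Φ : ℂ → EFiber →ₗᵢ[ℝ] ℍ) : Prop :=
  ∀ z ∈ V, ∀ s : ℂ → EFiber, DifferentiableAt ℝ s z → ∀ X : ℂ,
    normalCov f (fun w => Φ w (s w)) z X = Φ z (D.cov s z X)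

/-! ### Spinors of `ℝ⁴` -/

/-- `Spin(4) = S³ × S³`. -/
abbrev Spin4 : Type := unitary ℍ × unitary ℍ

/-- The double cover `Spin(4) → SO(4)`: `θ(p, q) x = p x q⁻¹`. -/
def theta (s : Spin4) (x : ℍ) : ℍ := (s.1 : ℍ) * x * ((s.2 : ℍ))⁻¹

/-- The spinor representation of `Spin(4)` on `Σ₄ = ℍ²`: `(p, q) (a, b) = (p a, q b)`. -/
def chi4 (s : Spin4) (u : ℍ × ℍ) : ℍ × ℍ := ((s.1 : ℍ) * u.1, (s.2 : ℍ) * u.2)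

theorem chi4_mul (s t : Spin4) (u : ℍ × ℍ) : chi4 (s * t) u = chi4 s (chi4 t u) := by
  simp [chi4, mul_assoc]

theorem chi4_one (u : ℍ × ℍ) : chi4 1 u = u := by
  simp [chi4]

/-- The equivalence `(s, u) ∼ (s g⁻¹, χ₄(g) u)` of pairs (spinor frame, components). -/
def spinorSetoid : Setoid (Spin4 × (ℍ × ℍ)) where
  r x y := ∃ g : Spin4, y = (x.1 * g⁻¹, chi4 g x.2)
  iseqv :=
    { refl := fun x => ⟨1, by simp [chi4_one]⟩
      symm := by
        rintro x y ⟨g, rfl⟩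
        exact ⟨g⁻¹, by simp [← chi4_mul, chi4_one]⟩
      trans := by
        rintro x y w ⟨g, rfl⟩ ⟨h, rfl⟩
        exact ⟨h * g, by simp [chi4_mul, mul_assoc]⟩ }

/-- The fibre of the spinor bundle `Spin(4) ×_{χ₄} Σ₄` of `ℝ⁴`. Spinor frames of `ℝ⁴` are written
relative to the constant spinor frame `(1, 1)`, so this fibre is the same at every point, and a
spinor field on `ℝ⁴` is a map `ℍ → Spinor`. -/
def Spinor : Type := Quotient spinorSetoid

/-- The spinor with components `u` in the spinor frame `s`. -/
def Spinor.mk (s : Spin4) (u : ℍ × ℍ) : Spinor := Quotient.mk spinorSetoid (s, u)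

/-- The components of a spinor in the constant spinor frame `(1, 1)`. -/
def Spinor.coords : Spinor → ℍ × ℍ :=
  Quotient.lift (fun x : Spin4 × (ℍ × ℍ) => chi4 x.1 x.2) (by
    rintro x y ⟨g, rfl⟩
    simp [← chi4_mul])

/-- The spinor field `φ` on `ℝ⁴` is parallel: it is smooth, and its covariant derivative, which in
the constant spinor frame is the derivative of its components, vanishes. -/
def IsParallelSpinor (φ : ℍ → Spinor) : Prop :=
  ContDiff ℝ ∞ (fun x => (φ x).coords) ∧
    ∀ x X : ℍ, fderiv ℝ (fun y => (φ y).coords) x X = 0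

/-- `s = (p, q)` is a moving spinor frame along `f` on `V` lying over the adapted orthonormal frame
`e₁ = e^{-ρ} f_x`, `e₂ = e^{-ρ} f_y`, `Φ e₃`, `Φ e₄`. -/
structure IsAdaptedSpinFrame (ρ : ℂ → ℝ) (f : ℂ → ℍ) (Φ : ℂ → EFiber →ₗᵢ[ℝ] ℍ) (V : Set ℂ)
    (s : ℂ → Spin4) : Prop where
  smooth_fst : ContDiffOn ℝ ∞ (fun z => ((s z).1 : ℍ)) V
  smooth_snd : ContDiffOn ℝ ∞ (fun z => ((s z).2 : ℍ)) V
  theta_one : ∀ z ∈ V, theta (s z) 1 = Real.exp (-ρ z) • dX f z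
  theta_i : ∀ z ∈ V, theta (s z) qi = Real.exp (-ρ z) • dY f z
  theta_j : ∀ z ∈ V, theta (s z) qj = Φ z e3
  theta_k : ∀ z ∈ V, theta (s z) qk = Φ z e4

/-- The spinor field `z ↦ [s z, (a z, b z)]` along `f` on `V` is the restriction of a parallel
spinor field of `ℝ⁴`. -/
def IsRestrictionOfParallel (f : ℂ → ℍ) (V : Set ℂ) (s : ℂ → Spin4) (a b : ℂ → ℍ) : Prop :=
  ∃ φ : ℍ → Spinor, IsParallelSpinor φ ∧ ∀ z ∈ V, φ (f z) = Spinor.mk (s z) (a z, b z)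

end SpinSurface

end

namespace SpinSurface

/-! ### The connection in the frame `(e₃, e₄)` -/

/-! Put α = da a⁻¹ and β = db b⁻¹. Constant norms make α and β imaginary, so the Dirac system fixes
their i-components in terms of dρ and c, and gives e^ρ H through two combinations of j- and
k-components for each of α and β. Everything follows from one formula: for an ℍ-valued function n,
the derivative of a⁻¹ n b along X is a⁻¹(-α(X) n + dn(X) + n β(X)) b (`hasFDerivAt_inv_mul_mul`).

For n = e^ρ Y with Y in ℂ, symmetry in X and Y is the closedness of ξ (`fderiv_xi_symm`). Its ℂ-part
holds because the dρ terms match, and its j,k-part because the same H occurs in both equations.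

If |a| = |b|, then x ↦ a⁻¹ x b is a rotation. It sends ℂ to the tangent plane and ℝj + ℝk to the
normal plane, whence Φ(v) = a⁻¹(v₃ j + v₄ k) b. The j,k-part of the formula gives the normal
connection when n has values in ℝj + ℝk (`preservesConnection_normalIdent`), and the second
fundamental form when n = e^ρ Y (`meanCurvature_eq`).

The lift (p, q) = (r a⁻¹, r b⁻¹) of this rotation, r = |a|, turns (a, b) into the constant (r, r).
Any other adapted lift gives ±(r, r), with a locally constant sign. -/

@[simp] theorem e3_zero : e3 0 = 1 := by simp [e3]

@[simp] theorem e3_one : e3 1 = 0 := by simp [e3]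

@[simp] theorem e4_zero : e4 0 = 0 := by simp [e4]

@[simp] theorem e4_one : e4 1 = 1 := by simp [e4]

theorem EFiber.eq_frame (v : EFiber) : v = v 0 • e3 + v 1 • e4 := by
  ext i
  fin_cases i <;> simp

theorem inner_EFiber (v w : EFiber) : inner ℝ v w = v 0 * w 0 + v 1 * w 1 := by
  simp [PiLp.inner_apply, Fin.sum_univ_two, mul_comm]

/-- Translates ordinary differentiability into the bundle form required by the `leibniz` and `add`
rules of a covariant derivative. -/
theorem mdifferentiableAt_section {s : ℂ → EFiber} {z : ℂ} (hs : DifferentiableAt ℝ s z) :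
    MDifferentiableAt (modelWithCornersSelf ℝ ℂ)
      ((modelWithCornersSelf ℝ ℂ).prod (modelWithCornersSelf ℝ EFiber))
      (fun x => (⟨x, s x⟩ : Bundle.TotalSpace EFiber (Bundle.Trivial ℂ EFiber))) z := by
  rw [mdifferentiableAt_totalSpace]
  exact ⟨mdifferentiableAt_id, mdifferentiableAt_iff_differentiableAt.2 hs⟩

namespace MetricConnection

variable {U : Set ℂ} (D : MetricConnection U)

/-- The connection form `X ↦ ⟨∇ᴱ_X e₃, e₄⟩`. -/
noncomputable def form (z X : ℂ) : ℝ := inner ℝ (D.cov (fun _ => e3) z X) e4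

theorem form_eq (z X : ℂ) : D.form z X = X.re * D.cx z + X.im * D.cy z := by
  have hX : X = X.re • (1 : ℂ) + X.im • Complex.I := by
    simp [Complex.re_add_im]
  have h : D.cov (fun _ => e3) z X
      = X.re • D.cov (fun _ => e3) z 1 + X.im • D.cov (fun _ => e3) z Complex.I := by
    conv_lhs => rw [hX]
    rw [map_add, map_smul, map_smul]
  rw [form, h, inner_add_left, real_inner_smul_left, real_inner_smul_left]
  rfl

/-- Since |e₃|² is constant, metric compatibility makes ∇e₃ orthogonal to e₃. -/
theorem cov_e3 {z : ℂ} (hz : z ∈ U) (X : ℂ) :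
    D.cov (fun _ => e3) z X = D.form z X • e4 := by
  have h := D.metric z hz (fun _ => e3) (fun _ => e3) (by fun_prop) (by fun_prop) X
  simp only [fderiv_fun_const, Pi.zero_apply, zero_apply] at h
  have h0 : (D.cov (fun _ => e3) z X) 0 = 0 := by
    simp [inner_EFiber] at h
    linarith
  ext i
  fin_cases i
  · simp [h0]
  · simp [form, inner_EFiber]

theorem cov_e4 {z : ℂ} (hz : z ∈ U) (X : ℂ) :
    D.cov (fun _ => e4) z X = -D.form z X • e3 := by
  have h := D.metric z hz (fun _ => e4) (fun _ => e4) (by fun_prop) (by fun_prop) X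
  have h' := D.metric z hz (fun _ => e3) (fun _ => e4) (by fun_prop) (by fun_prop) X
  simp only [fderiv_fun_const, Pi.zero_apply, zero_apply] at h h'
  rw [D.cov_e3 hz] at h'
  simp [inner_EFiber] at h h'
  ext i
  fin_cases i
  · simp
    linarith
  · simp
    linarith

theorem cov_smul_const {z : ℂ} (hz : z ∈ U) {g : ℂ → ℝ} (hg : DifferentiableAt ℝ g z)
    (v : EFiber) (X : ℂ) :
    D.cov (fun w => g w • v) z X = g z • D.cov (fun _ => v) z X + fderiv ℝ g z X • v := by
  have h := D.isCovariantDerivativeOn.leibniz (σ := fun _ => v) (g := g)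
    (mdifferentiableAt_section (differentiableAt_const v))
    (mdifferentiableAt_iff_differentiableAt.2 hg) hz
  have h2 := congrArg (fun T : ℂ →L[ℝ] EFiber => T X) h
  simp only [mvfderiv, mfderiv_eq_fderiv] at h2
  exact h2

/-- The covariant derivative of a section in terms of its components. -/
theorem cov_eq {z : ℂ} (hz : z ∈ U) {s : ℂ → EFiber} (hs : DifferentiableAt ℝ s z) (X : ℂ) :
    D.cov s z X = (fderiv ℝ s z X 0 - D.form z X * s z 1) • e3
      + (fderiv ℝ s z X 1 + D.form z X * s z 0) • e4 := by
  have hcoord : ∀ i : Fin 2, HasFDerivAt (fun w => s w i)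
      ((EuclideanSpace.proj i : EFiber →L[ℝ] ℝ).comp (fderiv ℝ s z)) z := fun i =>
    (EuclideanSpace.proj i : EFiber →L[ℝ] ℝ).hasFDerivAt.comp z hs.hasFDerivAt
  have hfd : ∀ i : Fin 2, fderiv ℝ (fun w => s w i) z X = fderiv ℝ s z X i := fun i => by
    rw [(hcoord i).fderiv]
    rfl
  have hsum : s = (fun w => s w 0 • e3) + (fun w => s w 1 • e4) :=
    funext fun w => EFiber.eq_frame (s w)
  have h0 := (hcoord 0).differentiableAt
  have h1 := (hcoord 1).differentiableAt
  have h := D.isCovariantDerivativeOn.add (σ := fun w => s w 0 • e3) (σ' := fun w => s w 1 • e4)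
    (mdifferentiableAt_section (h0.smul_const e3)) (mdifferentiableAt_section (h1.smul_const e4)) hz
  have hX := congrArg (fun T : ℂ →L[ℝ] EFiber => T X) h
  have hX' : D.cov s z X = D.cov (fun w => s w 0 • e3) z X + D.cov (fun w => s w 1 • e4) z X := by
    conv_lhs => rw [hsum]
    exact hX
  rw [hX', D.cov_smul_const hz h0, D.cov_smul_const hz h1, D.cov_e3 hz, D.cov_e4 hz,
    hfd, hfd]
  module

end MetricConnection

/-! ### Quaternionic calculus -/

@[simp] theorem qi_re : qi.re = 0 := rfl

@[simp] theorem qi_imI : qi.imI = 1 := rfl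

@[simp] theorem qi_imJ : qi.imJ = 0 := rfl

@[simp] theorem qi_imK : qi.imK = 0 := rfl

@[simp] theorem qj_re : qj.re = 0 := rfl

@[simp] theorem qj_imI : qj.imI = 0 := rfl

@[simp] theorem qj_imJ : qj.imJ = 1 := rfl

@[simp] theorem qj_imK : qj.imK = 0 := rfl

@[simp] theorem qk_re : qk.re = 0 := rfl

@[simp] theorem qk_imI : qk.imI = 0 := rfl

@[simp] theorem qk_imJ : qk.imJ = 0 := rfl

@[simp] theorem qk_imK : qk.imK = 1 := rfl

theorem contDiff_quaternion_star : ContDiff ℝ ∞ (fun x : ℍ => star x) :=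
  (LinearMap.toContinuousLinearMap
    { toFun := star, map_add' := star_add, map_smul' := Quaternion.star_smul } : ℍ →L[ℝ] ℍ).contDiff

/-- At constant norm, inversion is a fixed real multiple of conjugation, which is linear. -/
theorem _root_.ContDiffOn.quaternion_inv {a : ℂ → ℍ} {U : Set ℂ} (ha : ContDiffOn ℝ ∞ a U)
    {r : ℝ} (hr : ∀ z ∈ U, ‖a z‖ = r) : ContDiffOn ℝ ∞ (fun z => (a z)⁻¹) U := by
  refine ((contDiff_quaternion_star.comp_contDiffOn ha).const_smul (r * r)⁻¹).congr fun z hz => ?_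
  simp [Quaternion.inv_def, Quaternion.normSq_eq_norm_mul_self, hr z hz]

/-- The right logarithmic derivative `da(X) a⁻¹`. -/
noncomputable def rightLogDeriv (a : ℂ → ℍ) (z X : ℂ) : ℍ := fderiv ℝ a z X * (a z)⁻¹

theorem rightLogDeriv_eq (a : ℂ → ℍ) (z X : ℂ) :
    rightLogDeriv a z X
      = X.re • rightLogDeriv a z 1 + X.im • rightLogDeriv a z Complex.I := by
  have hX : X = X.re • (1 : ℂ) + X.im • Complex.I := by
    simp [Complex.re_add_im]
  have h : fderiv ℝ a z X = X.re • fderiv ℝ a z 1 + X.im • fderiv ℝ a z Complex.I := by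
    conv_lhs => rw [hX]
    rw [map_add, map_smul, map_smul]
  rw [rightLogDeriv, h, add_mul, smul_mul_assoc, smul_mul_assoc]
  rfl

/-- The right logarithmic derivative of a function of constant norm is imaginary. -/
theorem re_fderiv_mul_inv {a : ℂ → ℍ} {U : Set ℂ} (hU : IsOpen U) {r : ℝ}
    (hr : ∀ z ∈ U, ‖a z‖ = r) {z : ℂ} (hz : z ∈ U) (ha : DifferentiableAt ℝ a z) (X : ℂ) :
    (rightLogDeriv a z X).re = 0 := by
  have h1 : (fun w => inner ℝ (a w) (a w)) =ᶠ[nhds z] fun _ => r * r := by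
    filter_upwards [hU.mem_nhds hz] with w hw
    rw [real_inner_self_eq_norm_mul_norm, hr w hw]
  have h2 := congrArg (fun T : ℂ →L[ℝ] ℝ => T X) h1.fderiv_eq
  simp only [fderiv_inner_apply ℝ ha ha, fderiv_fun_const, Pi.zero_apply, zero_apply] at h2
  rw [real_inner_comm] at h2
  have h3 : inner ℝ (fderiv ℝ a z X) (a z) = 0 := by linarith
  -- The inverse is a real multiple of the conjugate, and the real part of x ȳ is the inner product
  -- of x and y.
  rw [rightLogDeriv, Quaternion.inv_def, mul_smul_comm, Quaternion.re_smul, ← Quaternion.inner_def, h3, smul_zero]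

/-- The derivative of `a⁻¹ c b`, in terms of the right logarithmic derivatives of `a` and `b`. -/
theorem hasFDerivAt_inv_mul_mul {a b c : ℂ → ℍ} {c' : ℂ →L[ℝ] ℍ} {z : ℂ}
    (ha : DifferentiableAt ℝ a z) (hb : DifferentiableAt ℝ b z) (hc : HasFDerivAt c c' z)
    (ha0 : a z ≠ 0) (hb0 : b z ≠ 0) (X : ℂ) :
    fderiv ℝ (fun w => (a w)⁻¹ * (c w * b w)) z X
      = (a z)⁻¹ * ((-rightLogDeriv a z X * c z + c' X
          + c z * rightLogDeriv b z X) * b z) := by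
  have h := ((hasFDerivAt_inv' (𝕜 := ℝ) ha0).comp z ha.hasFDerivAt).mul'
    (hc.mul' hb.hasFDerivAt)
  have h2 := congrArg (fun T : ℂ →L[ℝ] ℍ => T X) h.fderiv
  refine h2.trans ?_
  simp only [Function.comp_apply, Pi.mul_apply, add_apply,
    smul_apply, ContinuousLinearMap.comp_apply, neg_apply,
    ContinuousLinearMap.mulLeftRight_apply, smul_eq_mul, MulOpposite.smul_eq_mul_unop,
    MulOpposite.unop_op, rightLogDeriv]
  have hbb : c z * (fderiv ℝ b z X * (b z)⁻¹) * b z = c z * fderiv ℝ b z X := by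
    rw [mul_assoc, mul_assoc, inv_mul_cancel₀ hb0, mul_one]
  rw [add_mul, hbb]
  noncomm_ring

/-! ### Unit quaternions, the rotation x ↦ a⁻¹ x b, and constant spinors. -/

open Classical in
/-- The unit quaternion in the direction of `q`, and `1` if `q = 0`. -/
noncomputable def unitize (q : ℍ) : unitary ℍ :=
  if h : q = 0 then 1 else ⟨‖q‖⁻¹ • q, by
    have hn : ‖q‖ ≠ 0 := norm_ne_zero_iff.2 h
    have h1 : ‖q‖⁻¹ * ‖q‖⁻¹ * (‖q‖ * ‖q‖) = 1 := by field_simp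
    rw [Unitary.mem_iff]
    constructor
    · rw [Quaternion.star_smul, smul_mul_smul_comm, Quaternion.star_mul_self,
        Quaternion.normSq_eq_norm_mul_self, ← Quaternion.coe_mul_eq_smul,
        ← Quaternion.coe_mul, h1, Quaternion.coe_one]
    · rw [Quaternion.star_smul, smul_mul_smul_comm, Quaternion.self_mul_star,
        Quaternion.normSq_eq_norm_mul_self, ← Quaternion.coe_mul_eq_smul,
        ← Quaternion.coe_mul, h1, Quaternion.coe_one]⟩

theorem coe_unitize {q : ℍ} (h : q ≠ 0) : (unitize q : ℍ) = ‖q‖⁻¹ • q := by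
  simp [unitize, h]

theorem norm_unitary (q : unitary ℍ) : ‖(q : ℍ)‖ = 1 := CStarRing.norm_coe_unitary q

/-- The rotation `θ(s)` of `ℝ⁴` as a linear isometry. -/
noncomputable def thetaLI (s : Spin4) : ℍ →ₗᵢ[ℝ] ℍ where
  toFun := theta s
  map_add' x y := by simp [theta, mul_add, add_mul]
  map_smul' r x := by simp [theta]
  norm_map' x := by
    change ‖theta s x‖ = ‖x‖
    simp [theta]

theorem thetaLI_apply (s : Spin4) (x : ℍ) : thetaLI s x = theta s x := rfl

/-- The isometry `v₃ e₃ + v₄ e₄ ↦ v₃ j + v₄ k`. -/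
noncomputable def normalModel : EFiber →ₗᵢ[ℝ] ℍ where
  toFun v := v 0 • qj + v 1 • qk
  map_add' v w := by simp only [PiLp.add_apply]; module
  map_smul' r v := by simp only [PiLp.smul_apply, RingHom.id_apply, smul_eq_mul]; module
  norm_map' v := by
    refine (sq_eq_sq₀ (norm_nonneg _) (norm_nonneg _)).1 ?_
    rw [pow_two, pow_two, ← real_inner_self_eq_norm_mul_norm, ← real_inner_self_eq_norm_mul_norm,
      inner_EFiber, Quaternion.inner_self, Quaternion.normSq_def']
    simp
    ring

theorem normalModel_apply (v : EFiber) : normalModel v = v 0 • qj + v 1 • qk := rfl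

/-- The spinor frame in which a spinor with components `(a, b)` of equal nonzero norm has equal
positive real components. -/
noncomputable def realFrame (a b : ℍ) : Spin4 := (unitize a⁻¹, unitize b⁻¹)

/-- The frame is (r a⁻¹, r b⁻¹), and the two factors r cancel. This is where equality of the norms
enters. -/
theorem theta_realFrame {a b : ℍ} {r : ℝ} (hr : 0 < r) (ha : ‖a‖ = r) (hb : ‖b‖ = r) (x : ℍ) :
    theta (realFrame a b) x = a⁻¹ * (x * b) := by
  have ha0 : a ≠ 0 := norm_pos_iff.1 (ha ▸ hr)
  have hb0 : b ≠ 0 := norm_pos_iff.1 (hb ▸ hr)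
  simp only [theta, realFrame, coe_unitize (inv_ne_zero ha0), coe_unitize (inv_ne_zero hb0),
    norm_inv, ha, hb, inv_inv, smul_mul_assoc]
  rw [smul_inv₀, inv_inv, mul_smul_comm, smul_smul, mul_inv_cancel₀ hr.ne', one_smul, mul_assoc]

theorem chi4_realFrame {a b : ℍ} {r : ℝ} (hr : 0 < r) (ha : ‖a‖ = r) (hb : ‖b‖ = r) :
    chi4 (realFrame a b) (a, b) = ((r : ℍ), (r : ℍ)) := by
  have ha0 : a ≠ 0 := norm_pos_iff.1 (ha ▸ hr)
  have hb0 : b ≠ 0 := norm_pos_iff.1 (hb ▸ hr)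
  simp only [chi4, realFrame, coe_unitize (inv_ne_zero ha0), coe_unitize (inv_ne_zero hb0),
    norm_inv, ha, hb, inv_inv, smul_mul_assoc, inv_mul_cancel₀ ha0, inv_mul_cancel₀ hb0]
  ext <;> simp

/-- Changing frame by g = `s z` moves the spinor to the constant frame (1, 1), where its components
are u; the constant field with these components extends it. -/
theorem isRestrictionOfParallel_of_chi4_eq {f : ℂ → ℍ} {V : Set ℂ} {s : ℂ → Spin4} {a b : ℂ → ℍ}
    {u : ℍ × ℍ} (h : ∀ z ∈ V, chi4 (s z) (a z, b z) = u) : IsRestrictionOfParallel f V s a b := by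
  refine ⟨fun _ => Spinor.mk 1 u, ⟨contDiff_const, fun x X => by simp⟩, fun z hz => ?_⟩
  exact (Quotient.sound (s := spinorSetoid) ⟨s z, by simp [h z hz]⟩ :
    Spinor.mk (s z) (a z, b z) = Spinor.mk 1 u).symm

/-- A quaternion commuting with `i` and `j` is real. -/
theorem eq_re_of_commute {x : ℍ} (hi : x * qi = qi * x) (hj : x * qj = qj * x) :
    x = (x.re : ℍ) := by
  have h1 := congrArg QuaternionAlgebra.imJ hi
  have h2 := congrArg QuaternionAlgebra.imK hi
  have h3 := congrArg QuaternionAlgebra.imK hj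
  simp at h1 h2 h3
  ext <;> simp <;> linarith

/-- Two spinor frames with the same underlying rotation as the map `x ↦ a⁻¹ x b` give `(a, b)`
equal real components. -/
theorem exists_chi4_eq_of_theta_eq {s : Spin4} {a b : ℍ} (ha : a ≠ 0) (hb : b ≠ 0)
    (h1 : theta s 1 = a⁻¹ * (1 * b)) (hi : theta s qi = a⁻¹ * (qi * b))
    (hj : theta s qj = a⁻¹ * (qj * b)) :
    chi4 s (a, b) = ((((s.1 : ℍ) * a).re : ℍ), (((s.1 : ℍ) * a).re : ℍ)) := by
  obtain ⟨p, q⟩ := s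
  have hp : (p : ℍ) ≠ 0 := norm_pos_iff.1 (by rw [norm_unitary]; exact one_pos)
  have hq : (q : ℍ) ≠ 0 := norm_pos_iff.1 (by rw [norm_unitary]; exact one_pos)
  -- With inverses cleared, x = 1 gives ap = bq, and then x = i, j show that this quaternion
  -- commutes with i and j.
  have key : ∀ x : ℍ, theta (p, q) x = a⁻¹ * (x * b) → a * p * x = x * (b * q) := by
    intro x hx
    have := congrArg (fun y => a * y * (q : ℍ)) hx
    simp only [theta] at this
    rw [mul_inv_cancel_left₀ ha] at this
    simpa [mul_assoc, inv_mul_cancel₀ hq] using this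
  have hl : a * p = b * q := by simpa using key 1 h1
  have hreal := eq_re_of_commute (x := a * p) (by rw [key qi hi, hl]) (by rw [key qj hj, hl])
  -- The components are pa and qb rather than ap and bq; a real product does not depend on the order
  -- of its factors.
  have hcomm : ∀ {u v : ℍ} {t : ℝ}, u ≠ 0 → u * v = (t : ℍ) → v * u = (t : ℍ) := by
    intro u v t hu h
    apply mul_left_cancel₀ hu
    rw [← mul_assoc, h, Quaternion.coe_commutes]
  have e1 := hcomm ha hreal
  have e2 := hcomm hb (hl.symm.trans hreal)
  simp only [chi4, Prod.mk.injEq]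
  rw [e1, e2]
  simp

section

/-! ### The components of the Dirac system -/

/-- The real components of the Dirac system at `z`, in terms of the right logarithmic derivatives
of `a` and `b`, which are imaginary. -/
structure DiracComponents {U : Set ℂ} (ρ : ℂ → ℝ) (D : MetricConnection U) (H : ℂ → EFiber)
    (a b : ℂ → ℍ) (z : ℂ) : Prop where
  re_a : ∀ X, (rightLogDeriv a z X).re = 0
  re_b : ∀ X, (rightLogDeriv b z X).re = 0
  a_x_i : (rightLogDeriv a z 1).imI = (dY ρ z - D.cx z) / 2
  a_y_i : (rightLogDeriv a z Complex.I).imI = -(dX ρ z + D.cy z) / 2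
  a_j : (rightLogDeriv a z 1).imJ + (rightLogDeriv a z Complex.I).imK = -(Real.exp (ρ z) * H z 0)
  a_k : (rightLogDeriv a z 1).imK - (rightLogDeriv a z Complex.I).imJ = -(Real.exp (ρ z) * H z 1)
  b_x_i : (rightLogDeriv b z 1).imI = -(dY ρ z + D.cx z) / 2
  b_y_i : (rightLogDeriv b z Complex.I).imI = (dX ρ z - D.cy z) / 2
  b_j : (rightLogDeriv b z 1).imJ - (rightLogDeriv b z Complex.I).imK = Real.exp (ρ z) * H z 0
  b_k : (rightLogDeriv b z 1).imK + (rightLogDeriv b z Complex.I).imJ = Real.exp (ρ z) * H z 1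

theorem SolvesDirac.components {U : Set ℂ} {ρ : ℂ → ℝ} {D : MetricConnection U} {H : ℂ → EFiber}
    {a b : ℂ → ℍ} (hD : SolvesDirac ρ D H a b) {z : ℂ} (hz : z ∈ U)
    (hra : ∀ X, (rightLogDeriv a z X).re = 0) (hrb : ∀ X, (rightLogDeriv b z X).re = 0) :
    DiracComponents ρ D H a b z := by
  obtain ⟨hB, hA⟩ := hD z hz
  rw [add_mul, mul_assoc] at hB
  rw [sub_mul, mul_assoc] at hA
  change rightLogDeriv b z 1 + qi * rightLogDeriv b z Complex.I = _ at hB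
  change rightLogDeriv a z 1 - qi * rightLogDeriv a z Complex.I = _ at hA
  simp only [dZ, dZbar, Quaternion.ext_iff] at hA hB
  have h1 := hra 1
  have h2 := hra Complex.I
  have h3 := hrb 1
  have h4 := hrb Complex.I
  simp [h1, h2] at hA
  simp [h3, h4] at hB
  obtain ⟨hA0, hA1, hA2, hA3⟩ := hA
  obtain ⟨hB0, hB1, hB2, hB3⟩ := hB
  constructor <;> first | assumption | linarith

/-! ### The form `ξ` -/

variable {U : Set ℂ} {ρ : ℂ → ℝ} {D : MetricConnection U} {H : ℂ → EFiber} {a b : ℂ → ℍ}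

/-- Puts e^ρ into the middle factor, the shape a⁻¹ c b that `hasFDerivAt_inv_mul_mul`
differentiates. -/
theorem xi_apply' (ρ : ℂ → ℝ) (a b : ℂ → ℍ) (z X : ℂ) :
    xi ρ a b z X = (a z)⁻¹ * ((Real.exp (ρ z) • (X : ℍ)) * b z) := by
  rw [xi_apply, smul_mul_assoc, mul_smul_comm]

theorem contDiffOn_xi (hρ : ContDiffOn ℝ ∞ ρ U) (ha : ContDiffOn ℝ ∞ a U)
    (hb : ContDiffOn ℝ ∞ b U) {r : ℝ} (hna : ∀ z ∈ U, ‖a z‖ = r) :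
    ContDiffOn ℝ ∞ (xi ρ a b) U := by
  refine ContDiffOn.smul (Real.contDiff_exp.comp_contDiffOn hρ) (ContDiffOn.clm_comp
    ((ContinuousLinearMap.mul ℝ ℍ).contDiff.comp_contDiffOn (ha.quaternion_inv hna)) ?_)
  exact ((ContinuousLinearMap.mul ℝ ℍ).flip.contDiff.comp_contDiffOn hb).clm_comp contDiffOn_const

/-- The derivative of `z ↦ ξ_z(Y)` along `X`. -/
theorem fderiv_xi_const {z : ℂ} (hρ : DifferentiableAt ℝ ρ z)
    (ha : DifferentiableAt ℝ a z) (hb : DifferentiableAt ℝ b z) (ha0 : a z ≠ 0) (hb0 : b z ≠ 0)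
    (X Y : ℂ) :
    fderiv ℝ (fun w => xi ρ a b w Y) z X = Real.exp (ρ z) • ((a z)⁻¹ *
      ((-rightLogDeriv a z X * (Y : ℍ) + fderiv ℝ ρ z X • (Y : ℍ)
        + (Y : ℍ) * rightLogDeriv b z X) * b z)) := by
  simp only [xi_apply']
  rw [hasFDerivAt_inv_mul_mul ha hb (hρ.hasFDerivAt.exp.smul_const (Y : ℍ)) ha0 hb0 X]
  simp only [ContinuousLinearMap.smulRight_apply, smul_apply, smul_eq_mul]
  rw [← mul_smul_comm, ← smul_mul_assoc]
  simp only [smul_add, smul_smul, mul_smul_comm, smul_mul_assoc]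

theorem fderiv_xi {z : ℂ} (h : DifferentiableAt ℝ (xi ρ a b) z) (X Y : ℂ) :
    fderiv ℝ (xi ρ a b) z X Y = fderiv ℝ (fun w => xi ρ a b w Y) z X := by
  rw [fderiv_clm_apply h (differentiableAt_const Y)]
  simp

/-- By bilinearity only X = 1, Y = i matters, and there the claim is -α(1) i + ρ_x i + i β(1) =
-α(i) + ρ_y + β(i). In the real and i-parts c cancels; the j- and k-parts reduce to -e^ρ H₄ and e^ρ
H₃ computed once from the a-equation and once from the b-equation. -/
theorem fderiv_xi_symm {z : ℂ} (hρ : DifferentiableAt ℝ ρ z)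
    (ha : DifferentiableAt ℝ a z) (hb : DifferentiableAt ℝ b z) (ha0 : a z ≠ 0) (hb0 : b z ≠ 0)
    (h : DifferentiableAt ℝ (xi ρ a b) z) (hD : DiracComponents ρ D H a b z) (X Y : ℂ) :
    fderiv ℝ (xi ρ a b) z X Y = fderiv ℝ (xi ρ a b) z Y X := by
  have key : fderiv ℝ (xi ρ a b) z 1 Complex.I = fderiv ℝ (xi ρ a b) z Complex.I 1 := by
    rw [fderiv_xi h, fderiv_xi h, fderiv_xi_const hρ ha hb ha0 hb0,
      fderiv_xi_const hρ ha hb ha0 hb0]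
    congr 3
    change _ + (dX ρ z) • _ + _ = _ + (dY ρ z) • _ + _
    have := hD.re_a 1
    have := hD.re_a Complex.I
    have := hD.re_b 1
    have := hD.re_b Complex.I
    have := hD.a_x_i
    have := hD.a_y_i
    have := hD.a_j
    have := hD.a_k
    have := hD.b_x_i
    have := hD.b_y_i
    have := hD.b_j
    have := hD.b_k
    ext <;> simp <;> linarith
  have hexp : ∀ X : ℂ, X = X.re • (1 : ℂ) + X.im • Complex.I := fun X => by
    simp [Complex.re_add_im]
  rw [hexp X, hexp Y]
  simp only [map_add, map_smul, add_apply, smul_apply, key]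
  module

/-- The exterior derivative of a one-form is the antisymmetrization of its derivative. -/
theorem isClosedFormOn_of_symm {η : ℂ → ℂ →L[ℝ] ℍ} (hη : ∀ z ∈ U, DifferentiableAt ℝ η z)
    (h : ∀ z ∈ U, ∀ X Y, fderiv ℝ η z X Y = fderiv ℝ η z Y X) : IsClosedFormOn η U := by
  intro z hz
  have hd : DifferentiableAt ℝ
      (fun w => ContinuousAlternatingMap.ofSubsingleton ℝ ℂ ℍ (0 : Fin 1) (η w)) z :=
    ((ContinuousAlternatingMap.ofSubsingletonLIE (𝕜 := ℝ) (E := ℂ) (F := ℍ) (0 : Fin 1)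
      ).differentiable.differentiableAt.comp z (hη z hz) :)
  refine ContinuousAlternatingMap.ext fun v => ?_
  have hv : ∀ Y X, fderiv ℝ (fun w => η w Y) z X = fderiv ℝ η z X Y := fun Y X => by
    rw [fderiv_clm_apply (hη z hz) (differentiableAt_const Y)]
    simp
  rw [extDeriv_apply hd]
  simp [Fin.sum_univ_two, Fin.removeNth, hv, h z hz (v 0) (v 1)]

end

section

variable {U V : Set ℂ} {ρ : ℂ → ℝ} {D : MetricConnection U} {H : ℂ → EFiber} {a b f : ℂ → ℍ}
  {r : ℝ} {z : ℂ}

/-! ### The immersion -/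

theorem IsPrimitiveOn.contDiffOn {η : ℂ → ℂ →L[ℝ] ℍ} (hV : IsOpen V) (hf : IsPrimitiveOn η V f)
    (hη : ContDiffOn ℝ ∞ η V) : ContDiffOn ℝ ∞ f V := by
  rw [contDiffOn_infty_iff_fderiv_of_isOpen hV]
  exact ⟨fun z hz => (hf z hz).differentiableAt.differentiableWithinAt,
    hη.congr fun z hz => (hf z hz).fderiv⟩

theorem xi_injective (ha : a z ≠ 0) (hb : b z ≠ 0) : Function.Injective (xi ρ a b z) := by
  intro X Y h
  rw [xi_apply, xi_apply] at h
  have h1 := mul_right_cancel₀ hb (mul_left_cancel₀ (inv_ne_zero ha)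
    (smul_right_injective ℍ (Real.exp_pos (ρ z)).ne' h))
  exact Complex.ext (by simpa using congrArg QuaternionAlgebra.re h1)
    (by simpa using congrArg QuaternionAlgebra.imI h1)

theorem inner_coeComplex (X Y : ℂ) : inner ℝ (X : ℍ) (Y : ℍ) = inner ℝ X Y := by
  rw [Quaternion.inner_def, Complex.inner]
  simp
  ring

theorem xi_eq_thetaLI (hr : 0 < r) (ha : ‖a z‖ = r) (hb : ‖b z‖ = r) (X : ℂ) :
    xi ρ a b z X = Real.exp (ρ z) • thetaLI (realFrame (a z) (b z)) (X : ℍ) := by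
  rw [xi_apply, thetaLI_apply, theta_realFrame hr ha hb]

theorem thetaLI_normalModel_mem (hr : 0 < r) (ha : ‖a z‖ = r) (hb : ‖b z‖ = r)
    (hf : fderiv ℝ f z = xi ρ a b z) (v : EFiber) :
    thetaLI (realFrame (a z) (b z)) (normalModel v) ∈ normalSpace f z := by
  rw [normalSpace, Submodule.mem_orthogonal]
  rintro _ ⟨X, rfl⟩
  change inner ℝ (fderiv ℝ f z X) _ = 0
  rw [hf, xi_eq_thetaLI hr ha hb, real_inner_smul_left, LinearIsometry.inner_map_map,
    Quaternion.inner_def, normalModel_apply]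
  simp

/-- The normal projection in the moving frame. -/
theorem normalProj_thetaLI (hr : 0 < r) (ha : ‖a z‖ = r) (hb : ‖b z‖ = r)
    (hf : fderiv ℝ f z = xi ρ a b z) (y : ℍ) :
    normalProj f z (thetaLI (realFrame (a z) (b z)) y)
      = thetaLI (realFrame (a z) (b z)) (normalModel !₂[y.imJ, y.imK]) := by
  refine Submodule.eq_starProjection_of_mem_orthogonal
    (thetaLI_normalModel_mem hr ha hb hf _) (Submodule.le_orthogonal_orthogonal _ ?_)
  -- Removing the j,k-part of y leaves its ℂ-part, which is tangential; e^{-ρ} undoes the conformal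
  -- factor of ξ.
  refine ⟨Real.exp (-ρ z) • (⟨y.re, y.imI⟩ : ℂ), ?_⟩
  change fderiv ℝ f z _ = _
  rw [hf, map_smul, xi_eq_thetaLI hr ha hb, smul_smul, ← Real.exp_add, neg_add_cancel,
    Real.exp_zero, one_smul, ← map_sub]
  congr 1
  rw [normalModel_apply]
  ext <;> simp

theorem thetaLI_surjective (s : Spin4) : Function.Surjective (thetaLI s) := fun u => by
  have hp : (s.1 : ℍ) ≠ 0 := norm_pos_iff.1 (by rw [norm_unitary]; exact one_pos)
  have hq : (s.2 : ℍ) ≠ 0 := norm_pos_iff.1 (by rw [norm_unitary]; exact one_pos)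
  refine ⟨(s.1 : ℍ)⁻¹ * (u * s.2), ?_⟩
  rw [thetaLI_apply, theta, mul_inv_cancel_left₀ hp, mul_inv_cancel_right₀ hq]

/-- The identification of `E` with the normal bundle: `v ↦ a⁻¹ (v₃ j + v₄ k) b`. -/
noncomputable def normalIdent (a b : ℂ → ℍ) (z : ℂ) : EFiber →ₗᵢ[ℝ] ℍ :=
  (thetaLI (realFrame (a z) (b z))).comp normalModel

theorem normalIdent_apply (v : EFiber) :
    normalIdent a b z v = thetaLI (realFrame (a z) (b z)) (normalModel v) := rfl

theorem normalIdent_eq (hr : 0 < r) (ha : ‖a z‖ = r) (hb : ‖b z‖ = r) (v : EFiber) :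
    normalIdent a b z v = (a z)⁻¹ * (normalModel v * b z) := by
  rw [normalIdent_apply, thetaLI_apply, theta_realFrame hr ha hb]

theorem inducesMetricOn_of_isPrimitiveOn (hr : 0 < r) (ha : ∀ z ∈ V, ‖a z‖ = r)
    (hb : ∀ z ∈ V, ‖b z‖ = r) (hf : IsPrimitiveOn (xi ρ a b) V f) : InducesMetricOn f ρ V := by
  intro z hz X Y
  rw [(hf z hz).fderiv, xi_eq_thetaLI hr (ha z hz) (hb z hz),
    xi_eq_thetaLI hr (ha z hz) (hb z hz), real_inner_smul_left, real_inner_smul_right,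
    LinearIsometry.inner_map_map, inner_coeComplex, two_mul, Real.exp_add, mul_assoc]

theorem isNormalIdentification_normalIdent (hr : 0 < r) (hna : ∀ z ∈ V, ‖a z‖ = r)
    (hnb : ∀ z ∈ V, ‖b z‖ = r) (ha : ContDiffOn ℝ ∞ a V) (hb : ContDiffOn ℝ ∞ b V)
    (hf : IsPrimitiveOn (xi ρ a b) V f) : IsNormalIdentification f V (normalIdent a b) := by
  refine ⟨fun v => ?_, fun z hz => le_antisymm ?_ fun u hu => ?_⟩
  · exact ((ha.quaternion_inv hna).mul (contDiffOn_const.mul hb)).congr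
      fun z hz => normalIdent_eq hr (hna z hz) (hnb z hz) v
  · rintro _ ⟨v, rfl⟩
    exact thetaLI_normalModel_mem hr (hna z hz) (hnb z hz) (hf z hz).fderiv v
  -- A normal vector is fixed by the normal projection, whose values already have the form Φ(v).
  · obtain ⟨y, rfl⟩ := thetaLI_surjective (realFrame (a z) (b z)) u
    have h := normalProj_thetaLI hr (hna z hz) (hnb z hz) (hf z hz).fderiv y
    rw [normalProj, Submodule.starProjection_eq_self_iff.2 hu] at h
    exact ⟨_, h.symm⟩

/-- For n = s₃ j + s₄ k, products of n with the j,k-parts of α and β lie in ℂ, hence are tangential.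
Only the i-component of α + β survives; there the derivatives of ρ cancel and -c remains, matching
`cov_eq`. -/
theorem preservesConnection_normalIdent (hV : IsOpen V) (hVU : V ⊆ U) (hr : 0 < r)
    (hna : ∀ z ∈ V, ‖a z‖ = r) (hnb : ∀ z ∈ V, ‖b z‖ = r)
    (ha : ∀ z ∈ V, DifferentiableAt ℝ a z) (hb : ∀ z ∈ V, DifferentiableAt ℝ b z)
    (hD : ∀ z ∈ V, DiracComponents ρ D H a b z)
    (hf : IsPrimitiveOn (xi ρ a b) V f) : PreservesConnection D f V (normalIdent a b) := by
  intro z hz s hs X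
  have ha0 : a z ≠ 0 := norm_pos_iff.1 (hna z hz ▸ hr)
  have hb0 : b z ≠ 0 := norm_pos_iff.1 (hnb z hz ▸ hr)
  have hev : (fun w => normalIdent a b w (s w))
      =ᶠ[nhds z] fun w => (a w)⁻¹ * (normalModel (s w) * b w) := by
    filter_upwards [hV.mem_nhds hz] with w hw
    exact normalIdent_eq hr (hna w hw) (hnb w hw) _
  have hc : HasFDerivAt (fun w => normalModel (s w))
      (normalModel.toContinuousLinearMap.comp (fderiv ℝ s z)) z :=
    normalModel.toContinuousLinearMap.hasFDerivAt.comp z hs.hasFDerivAt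
  rw [normalCov, hev.fderiv_eq, hasFDerivAt_inv_mul_mul (ha z hz) (hb z hz) hc ha0 hb0,
    ← theta_realFrame hr (hna z hz) (hnb z hz), ← thetaLI_apply,
    normalProj_thetaLI hr (hna z hz) (hnb z hz) (hf z hz).fderiv, normalIdent_apply,
    D.cov_eq (hVU hz) hs, D.form_eq, rightLogDeriv_eq a, rightLogDeriv_eq b]
  congr 2
  have h1 := (hD z hz).a_x_i
  have h2 := (hD z hz).a_y_i
  have h3 := (hD z hz).b_x_i
  have h4 := (hD z hz).b_y_i
  have h5 := (hD z hz).re_a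
  have h6 := (hD z hz).re_b
  ext i
  fin_cases i
  · simp [normalModel_apply, h1, h2, h3, h4, h5, h6]
    ring
  · simp [normalModel_apply, h1, h2, h3, h4, h5, h6]
    ring

/-- The term dρ(X) Y lies in ℂ, so the normal projection removes it. -/
theorem secondFF_eq (hV : IsOpen V) (hr : 0 < r)
    (hna : ∀ z ∈ V, ‖a z‖ = r) (hnb : ∀ z ∈ V, ‖b z‖ = r) (hz : z ∈ V)
    (hρ : DifferentiableAt ℝ ρ z) (ha : DifferentiableAt ℝ a z) (hb : DifferentiableAt ℝ b z)
    (hf : IsPrimitiveOn (xi ρ a b) V f) (X Y : ℂ) :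
    secondFF f z X Y = Real.exp (ρ z) • normalIdent a b z
      !₂[(-rightLogDeriv a z X * (Y : ℍ) + (Y : ℍ) * rightLogDeriv b z X).imJ,
        (-rightLogDeriv a z X * (Y : ℍ) + (Y : ℍ) * rightLogDeriv b z X).imK] := by
  have ha0 : a z ≠ 0 := norm_pos_iff.1 (hna z hz ▸ hr)
  have hb0 : b z ≠ 0 := norm_pos_iff.1 (hnb z hz ▸ hr)
  have hev : (fun w => fderiv ℝ f w Y) =ᶠ[nhds z] fun w => xi ρ a b w Y := by
    filter_upwards [hV.mem_nhds hz] with w hw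
    rw [(hf w hw).fderiv]
  rw [secondFF, hev.fderiv_eq, fderiv_xi_const hρ ha hb ha0 hb0,
    ← theta_realFrame hr (hna z hz) (hnb z hz), ← thetaLI_apply, map_smul,
    normalProj_thetaLI hr (hna z hz) (hnb z hz) (hf z hz).fderiv, normalIdent_apply]
  congr 4
  all_goals simp

/-- The trace combines the j,k-parts as the b-equation minus the a-equation; each contributes e^ρ H,
which accounts for the factor 1/2. -/
theorem meanCurvature_eq (hV : IsOpen V) (hr : 0 < r)
    (hna : ∀ z ∈ V, ‖a z‖ = r) (hnb : ∀ z ∈ V, ‖b z‖ = r) (hz : z ∈ V)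
    (hρ : DifferentiableAt ℝ ρ z) (ha : DifferentiableAt ℝ a z) (hb : DifferentiableAt ℝ b z)
    (hD : DiracComponents ρ D H a b z)
    (hf : IsPrimitiveOn (xi ρ a b) V f) : meanCurvature ρ f z = normalIdent a b z (H z) := by
  have hE : Real.exp (ρ z) * Real.exp (-ρ z) = 1 := by
    rw [← Real.exp_add, add_neg_cancel, Real.exp_zero]
  have h1 := hD.a_j
  have h2 := hD.a_k
  have h3 := hD.b_j
  have h4 := hD.b_k
  rw [meanCurvature, secondFF_eq hV hr hna hnb hz hρ ha hb hf,
    secondFF_eq hV hr hna hnb hz hρ ha hb hf, ← map_smul, ← map_smul, ← map_add, ← map_smul,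
    rightLogDeriv_eq a, rightLogDeriv_eq b, rightLogDeriv_eq a (X := _ * Complex.I),
    rightLogDeriv_eq b (X := _ * Complex.I)]
  congr 1
  generalize Real.exp (ρ z) = E at *
  generalize Real.exp (-ρ z) = e at *
  ext i
  fin_cases i
  · simp
    -- The Dirac relations leave (E²e² - 1) H₃, which factors through Ee - 1.
    linear_combination (E * e * e / 2) * (h3 - h1) + (H z 0) * (E * e + 1) * hE
  · simp
    linear_combination (E * e * e / 2) * (h4 - h2) + (H z 1) * (E * e + 1) * hE

/-! ### Spinor frames along the immersion -/

theorem isAdaptedSpinFrame_realFrame (hr : 0 < r)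
    (hna : ∀ z ∈ V, ‖a z‖ = r) (hnb : ∀ z ∈ V, ‖b z‖ = r) (ha : ContDiffOn ℝ ∞ a V)
    (hb : ContDiffOn ℝ ∞ b V) (hf : IsPrimitiveOn (xi ρ a b) V f) :
    IsAdaptedSpinFrame ρ f (normalIdent a b) V (fun z => realFrame (a z) (b z)) := by
  have hne : ∀ {u : ℂ → ℍ} (_ : ∀ z ∈ V, ‖u z‖ = r) z, z ∈ V → u z ≠ 0 := fun h z hz =>
    norm_pos_iff.1 (h z hz ▸ hr)
  have hsmooth : ∀ {u : ℂ → ℍ} (_ : ∀ z ∈ V, ‖u z‖ = r) (_ : ContDiffOn ℝ ∞ u V),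
      ContDiffOn ℝ ∞ (fun z => (unitize (u z)⁻¹ : ℍ)) V := fun {u} h hu =>
    ((hu.quaternion_inv h).const_smul r).congr fun z hz => by
      simp [coe_unitize (inv_ne_zero (hne h z hz)), h z hz]
  have htan : ∀ z ∈ V, ∀ X : ℂ, theta (realFrame (a z) (b z)) (X : ℍ)
      = Real.exp (-ρ z) • fderiv ℝ f z X := fun z hz X => by
    rw [(hf z hz).fderiv, xi_eq_thetaLI hr (hna z hz) (hnb z hz), smul_smul, ← Real.exp_add,
      neg_add_cancel, Real.exp_zero, one_smul, thetaLI_apply]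
  refine ⟨hsmooth hna ha, hsmooth hnb hb, fun z hz => ?_, fun z hz => ?_, fun z hz => ?_,
    fun z hz => ?_⟩
  · simpa [dX] using htan z hz 1
  · have hI : ((Complex.I : ℂ) : ℍ) = qi := by ext <;> simp
    rw [← hI]
    exact htan z hz Complex.I
  · rw [normalIdent_apply, thetaLI_apply, normalModel_apply]
    simp
  · rw [normalIdent_apply, thetaLI_apply, normalModel_apply]
    simp

theorem IsAdaptedSpinFrame.isRestrictionOfParallel (hr : 0 < r)
    (hna : ∀ z ∈ V, ‖a z‖ = r) (hnb : ∀ z ∈ V, ‖b z‖ = r) (ha : ContDiffOn ℝ ∞ a V)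
    (hb : ContDiffOn ℝ ∞ b V) (hf : IsPrimitiveOn (xi ρ a b) V f) (hV : IsPreconnected V)
    {s : ℂ → Spin4} (hs : IsAdaptedSpinFrame ρ f (normalIdent a b) V s) :
    IsRestrictionOfParallel f V s a b := by
  have h0 := isAdaptedSpinFrame_realFrame hr hna hnb ha hb hf
  have hchi : ∀ z ∈ V, chi4 (s z) (a z, b z)
      = (((((s z).1 : ℍ) * a z).re : ℍ), ((((s z).1 : ℍ) * a z).re : ℍ)) := fun z hz => by
    refine exists_chi4_eq_of_theta_eq (norm_pos_iff.1 (hna z hz ▸ hr))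
      (norm_pos_iff.1 (hnb z hz ▸ hr)) ?_ ?_ ?_
    · rw [← theta_realFrame hr (hna z hz) (hnb z hz), hs.theta_one z hz, h0.theta_one z hz]
    · rw [← theta_realFrame hr (hna z hz) (hnb z hz), hs.theta_i z hz, h0.theta_i z hz]
    · rw [← theta_realFrame hr (hna z hz) (hnb z hz), hs.theta_j z hz, h0.theta_j z hz]
  -- The common component t is real with |t| = |p||a| = r. Being continuous on a preconnected set,
  -- it is r throughout or -r throughout.
  have hsq : Set.EqOn ((fun z => (((s z).1 : ℍ) * a z).re) ^ 2) ((fun _ => r) ^ 2) V := by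
    intro z hz
    have h1 : ((s z).1 : ℍ) * a z = ((((s z).1 : ℍ) * a z).re : ℍ) :=
      congrArg Prod.fst (hchi z hz)
    have h2 : ‖((((s z).1 : ℍ) * a z).re : ℍ)‖ = r := by
      rw [← h1, norm_mul, norm_unitary, hna z hz, one_mul]
    rw [Quaternion.norm_coe, Real.norm_eq_abs] at h2
    simp only [Pi.pow_apply]
    rw [← h2, sq_abs]
  have hcont : ContinuousOn (fun z => (((s z).1 : ℍ) * a z).re) V :=
    Quaternion.continuous_re.comp_continuousOn (hs.smooth_fst.continuousOn.mul ha.continuousOn)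
  rcases hV.eq_or_eq_neg_of_sq_eq hcont continuousOn_const hsq (fun _ => hr.ne') with h | h
  · refine isRestrictionOfParallel_of_chi4_eq (u := ((r : ℍ), (r : ℍ))) fun z hz => ?_
    have := h hz
    simp only at this
    rw [hchi z hz, this]
  · refine isRestrictionOfParallel_of_chi4_eq (u := (((-r : ℝ) : ℍ), ((-r : ℝ) : ℍ)))
      fun z hz => ?_
    have := h hz
    simp only [Pi.neg_apply] at this
    rw [hchi z hz, this]

end

end SpinSurface

/-! ### Assembly of the main theorem. -/

theorem theorem3
    (U : Set ℂ) (hU : IsOpen U)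
    (ρ : ℂ → ℝ) (hρ : ContDiffOn ℝ ∞ ρ U)
    (D : SpinSurface.MetricConnection U)
    (H : ℂ → SpinSurface.EFiber)
    (a b : ℂ → ℍ) (ha : ContDiffOn ℝ ∞ a U) (hb : ContDiffOn ℝ ∞ b U)
    (ra rb : ℝ) (hra : 0 < ra) (hrb : 0 < rb)
    (hna : ∀ z ∈ U, ‖a z‖ = ra) (hnb : ∀ z ∈ U, ‖b z‖ = rb)
    (hD : SpinSurface.SolvesDirac ρ D H a b) :
    SpinSurface.IsClosedFormOn (SpinSurface.xi ρ a b) U ∧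
    (∀ z₀ ∈ U, ∃ V : Set ℂ, IsOpen V ∧ z₀ ∈ V ∧ V ⊆ U ∧
      ∃ f : ℂ → ℍ, SpinSurface.IsPrimitiveOn (SpinSurface.xi ρ a b) V f) ∧
    ∀ V : Set ℂ, IsOpen V → V ⊆ U → ∀ f : ℂ → ℍ,
      SpinSurface.IsPrimitiveOn (SpinSurface.xi ρ a b) V f →
        SpinSurface.IsImmersionOn f V ∧
        (ra = rb →
          SpinSurface.InducesMetricOn f ρ V ∧
          ∃ Φ : ℂ → SpinSurface.EFiber →ₗᵢ[ℝ] ℍ,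
            SpinSurface.IsNormalIdentification f V Φ ∧
            SpinSurface.PreservesConnection D f V Φ ∧
            (∀ z ∈ V, SpinSurface.meanCurvature ρ f z = Φ z (H z)) ∧
            (∃ s : ℂ → SpinSurface.Spin4,
              SpinSurface.IsAdaptedSpinFrame ρ f Φ V s ∧
              SpinSurface.IsRestrictionOfParallel f V s a b) ∧
            (IsPreconnected V → ∀ s : ℂ → SpinSurface.Spin4,
              SpinSurface.IsAdaptedSpinFrame ρ f Φ V s →
                SpinSurface.IsRestrictionOfParallel f V s a b)) := by
  have hna' : ∀ z ∈ U, a z ≠ 0 := fun z hz => norm_pos_iff.1 (hna z hz ▸ hra)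
  have hnb' : ∀ z ∈ U, b z ≠ 0 := fun z hz => norm_pos_iff.1 (hnb z hz ▸ hrb)
  have hdiff : ∀ {W : Type} [NormedAddCommGroup W] [NormedSpace ℝ W] {u : ℂ → W},
      ContDiffOn ℝ ∞ u U → ∀ z ∈ U, DifferentiableAt ℝ u z := fun hu z hz =>
    (hu.contDiffAt (hU.mem_nhds hz)).differentiableAt (by simp)
  have hxi := SpinSurface.contDiffOn_xi hρ ha hb hna
  have hcomp : ∀ z ∈ U, SpinSurface.DiracComponents ρ D H a b z := fun z hz =>
    hD.components hz
      (SpinSurface.re_fderiv_mul_inv hU hna hz (hdiff ha z hz))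
      (SpinSurface.re_fderiv_mul_inv hU hnb hz (hdiff hb z hz))
  have hsymm : ∀ z ∈ U, ∀ X Y, fderiv ℝ (SpinSurface.xi ρ a b) z X Y
      = fderiv ℝ (SpinSurface.xi ρ a b) z Y X := fun z hz =>
    SpinSurface.fderiv_xi_symm (hdiff hρ z hz) (hdiff ha z hz) (hdiff hb z hz) (hna' z hz)
      (hnb' z hz) (hdiff hxi z hz) (hcomp z hz)
  refine ⟨SpinSurface.isClosedFormOn_of_symm (hdiff hxi) hsymm, fun z₀ hz₀ => ?_,
    fun V hV hVU f hf => ⟨⟨hf.contDiffOn hV (hxi.mono hVU), fun z hz => ?_⟩, ?_⟩⟩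
  -- Poincaré lemma on a ball, which is convex.
  · obtain ⟨ε, hε, hball⟩ := Metric.isOpen_iff.1 hU z₀ hz₀
    obtain ⟨f, hf⟩ := (convex_ball z₀ ε).exists_forall_hasFDerivAt_of_fderiv_symmetric
      Metric.isOpen_ball (hxi.mono hball |>.differentiableOn (by simp))
      (fun z hz => hsymm z (hball hz))
    exact ⟨Metric.ball z₀ ε, Metric.isOpen_ball, Metric.mem_ball_self hε, hball, f, hf⟩
  · rw [(hf z hz).fderiv]
    exact SpinSurface.xi_injective (hna' z (hVU hz)) (hnb' z (hVU hz))
  · rintro rfl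
    have hnaV : ∀ z ∈ V, ‖a z‖ = ra := fun z hz => hna z (hVU hz)
    have hnbV : ∀ z ∈ V, ‖b z‖ = ra := fun z hz => hnb z (hVU hz)
    have haV := ha.mono hVU
    have hbV := hb.mono hVU
    exact ⟨SpinSurface.inducesMetricOn_of_isPrimitiveOn hra hnaV hnbV hf,
      SpinSurface.normalIdent a b,
      SpinSurface.isNormalIdentification_normalIdent hra hnaV hnbV haV hbV hf,
      SpinSurface.preservesConnection_normalIdent hV hVU hra hnaV hnbV
        (fun z hz => hdiff ha z (hVU hz)) (fun z hz => hdiff hb z (hVU hz))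
        (fun z hz => hcomp z (hVU hz)) hf,
      fun z hz => SpinSurface.meanCurvature_eq hV hra hnaV hnbV hz (hdiff hρ z (hVU hz))
        (hdiff ha z (hVU hz)) (hdiff hb z (hVU hz)) (hcomp z (hVU hz)) hf,
      ⟨_, SpinSurface.isAdaptedSpinFrame_realFrame hra hnaV hnbV haV hbV hf,
        SpinSurface.isRestrictionOfParallel_of_chi4_eq fun z hz =>
          SpinSurface.chi4_realFrame hra (hnaV z hz) (hnbV z hz)⟩,
      fun hVc _ hs => hs.isRestrictionOfParallel hra hnaV hnbV haV hbV hf hVc⟩
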